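/- A JB-algebra is a real (commutative, not necessarily unital) Jordan algebra $A$ with a complete norm satisfying $\|ab\|\le\|a\|\|b\|$, $\|a^2\|=\|a\|^2$ and $\|a^2\|\le\|a^2+b^2\|$ for all $a,b\in A$. Put $A_+=\{a^2:a\in A\}$, order $A$ by $a\le b\iff b-a\in A_+$, let $P(A)=\{p\in A:p^2=p\}$ be the set of projections, and let $U_ab=2a(ab)-a^2b$. Projections $p,q$ are orthogonal if $pq=0$. A JB-algebra $A$ is called an AJW-algebra if (1) every set of pairwise orthogonal projections has a least upper bound in the partially ordered set $P(A)$; and (2) every maximal associative subalgebra $A_o$ of $A$ is the least norm-closed subalgebra containing $A_o\cap P(A)$. For $S\subseteq A$ put ${}^\perp(S)_+=\{x\in A_+: U_ax=0\text{ for all }a\in S\}$. **Lemma 2.4.** Let $A$ be an AJW-algebra and let $I$ be a norm-closed ideal of $A$, i.e. a norm-closed linear subspace with $ax\in I$ for all $a\in A$, $x\in I$. Then there exists a central projection $g\in A$ (that is, $g^2=g$ and $g(ab)=(ga)b$ for all $a,b\in A$) such that $${}^\perp\bigl({}^\perp(I)_+\bigr)_+=gA_+=\{ga:a\in A_+\}.$$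 -/

import Mathlib

/-- A JB-algebra: a real (commutative, not necessarily unital) Jordan algebra with a complete
norm such that `‖ab‖ ≤ ‖a‖‖b‖`, `‖a²‖ = ‖a‖²` and `‖a²‖ ≤ ‖a² + b²‖`. -/
class JBAlgebra (A : Type*) extends NormedAddCommGroup A, NonUnitalNonAssocCommRing A,
    NormedSpace ℝ A, IsCommJordan A, CompleteSpace A where
  /-- With commutativity of the product, this makes the product bilinear over `ℝ`. -/
  smul_mul : ∀ (r : ℝ) (a b : A), (r • a) * b = r • (a * b)
  norm_mul_le' : ∀ a b : A, ‖a * b‖ ≤ ‖a‖ * ‖b‖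
  norm_sq : ∀ a : A, ‖a * a‖ = ‖a‖ ^ 2
  norm_sq_le : ∀ a b : A, ‖a * a‖ ≤ ‖a * a + b * b‖

namespace JBAlgebra

/-- The operator `U_a b = {aba} = 2a(ab) - a²b`. -/
def U {A : Type*} [JBAlgebra A] (a b : A) : A :=
  (2 : ℝ) • (a * (a * b)) - (a * a) * b

/-- The positive cone `A₊` of a JB-algebra: the set of squares. -/
def posCone (A : Type*) [JBAlgebra A] : Set A := {x | ∃ a : A, x = a * a}

/-- The set `P(A)` of projections. -/
def projections (A : Type*) [JBAlgebra A] : Set A := {p | IsIdempotentElem p}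

/-- The order of a JB-algebra, `a ≤ b` iff `b - a ∈ A₊`. -/
def Le {A : Type*} [JBAlgebra A] (a b : A) : Prop := b - a ∈ posCone A

/-- `p` is the least upper bound of `S` in the partially ordered set `P(A)`. -/
def IsProjectionLUB {A : Type*} [JBAlgebra A] (S : Set A) (p : A) : Prop :=
  p ∈ projections A ∧ (∀ e ∈ S, Le e p) ∧
    ∀ q ∈ projections A, (∀ e ∈ S, Le e q) → Le p q

/-- The product is associative on the subalgebra `B`. -/
def IsAssociative {A : Type*} [JBAlgebra A] (B : NonUnitalSubalgebra ℝ A) : Prop :=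
  ∀ x ∈ B, ∀ y ∈ B, ∀ z ∈ B, (x * y) * z = x * (y * z)

/-- `⊥(S)₊ = {x ∈ A₊ : U_a x = 0 for all a ∈ S}`. -/
def annPos {A : Type*} [JBAlgebra A] (S : Set A) : Set A :=
  {x | x ∈ posCone A ∧ ∀ a ∈ S, U a x = 0}

/-- `I` is a (Jordan) ideal: a linear subspace with `ax ∈ I` for `a ∈ A`, `x ∈ I`. -/
def IsIdeal {A : Type*} [JBAlgebra A] (I : Submodule ℝ A) : Prop :=
  ∀ a : A, ∀ x ∈ I, a * x ∈ I

end JBAlgebra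

/-- An AJW-algebra: a JB-algebra in which every set of pairwise orthogonal projections has a
least upper bound in `P(A)`, and every maximal associative subalgebra is the least closed
subalgebra containing all its projections. -/
class IsAJWAlgebra (A : Type*) [JBAlgebra A] : Prop where
  exists_lub : ∀ S : Set A, S ⊆ JBAlgebra.projections A →
    S.Pairwise (fun p q => p * q = 0) → ∃ p : A, JBAlgebra.IsProjectionLUB S p
  generated : ∀ B : NonUnitalSubalgebra ℝ A, Maximal JBAlgebra.IsAssociative B →
    IsLeast {C : NonUnitalSubalgebra ℝ A |
      IsClosed (C : Set A) ∧ (B : Set A) ∩ JBAlgebra.projections A ⊆ C} B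

/-!
A nonzero element `x` of the closed ideal `I` is approximated by `U f x` for a projection `f` in the
closure of the range of `U x`; such an `f` is nonzero, lies in `I` and is orthogonal to every
projection that kills `x`. Let `g` be the supremum of a maximal orthogonal family `S` of projections
of `I`. By maximality `g` kills no nonzero element of `I`, so it is the unit of `I`. An element
orthogonal to all of `S` is orthogonal to `g`, again by approximation with projections; applied to
the half Peirce space of `g` this makes `g` central, and applied to `⊥(I)₊` it gives
`⊥(I)₊ = {x ≥ 0 : gx = 0}`. Taking `I = A` yields a unit `u` of `A`, and the second annihilator is
computed by testing against `u - g`.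

The order enters through the fact that `p ≤ e` implies `pe = p` for projections. Here `(e - p)²`
lies in the sum of the Peirce spaces of `p` for `1` and `0`, a closed subalgebra, hence so does the
positive square root `e - p`. Therefore `p` and `e` commute, and monotonicity of the norm rules out
`p - pe ≠ 0`.
-/

open Polynomial

namespace JordanRing

section Identities

variable {A : Type*} [NonUnitalNonAssocCommRing A] [IsCommJordan A] [IsAddTorsionFree A]

theorem jordan_linearized (a b c w : A) :
    a * ((b * c) * w) + b * ((c * a) * w) + c * ((a * b) * w) =
      (b * c) * (a * w) + (c * a) * (b * w) + (a * b) * (c * w) := by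
  have h : (2 : ℕ) • ((a * ((b * c) * w) - (b * c) * (a * w)) +
      (b * ((c * a) * w) - (c * a) * (b * w)) + (c * ((a * b) * w) - (a * b) * (c * w))) = 0 :=
    DFunLike.congr_fun (two_nsmul_lie_lmul_lmul_add_add_eq_zero a b c) w
  linear_combination (norm := abel) (nsmul_eq_zero_iff_right two_ne_zero).1 h

end Identities

section Powers

variable {R A : Type*} [CommRing R] [NonUnitalNonAssocCommRing A] [Module R A]
  [IsScalarTower R A A] [SMulCommClass R A A]

/-- The element `a · r(a)`: polynomials without constant term are evaluated at `a` by letting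
`r` act through the operator of multiplication by `a`. -/
noncomputable def mulAeval (a : A) : R[X] →ₗ[R] A :=
  LinearMap.applyₗ a ∘ₗ (aeval (LinearMap.mul R A a)).toLinearMap

theorem mulAeval_apply (a : A) (r : R[X]) :
    mulAeval a r = aeval (LinearMap.mul R A a) r a := rfl

theorem mulAeval_C (a : A) (c : R) : mulAeval a (C c) = c • a := by simp [mulAeval_apply]

theorem mulAeval_X_mul (a : A) (r : R[X]) : mulAeval a (X * r) = a * mulAeval a r := by
  simp [mulAeval_apply]

theorem mulAeval_C_mul_X_pow_succ (a : A) (n : ℕ) (c : R) :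
    mulAeval a (C c * X ^ (n + 1)) = a * mulAeval a (C c * X ^ n) := by
  rw [pow_succ', mul_left_comm, mulAeval_X_mul]

theorem mulAeval_mem {C : NonUnitalSubalgebra R A} {a : A} (ha : a ∈ C) (r : R[X]) :
    mulAeval a r ∈ C := by
  induction r using Polynomial.induction_on with
  | C c => rw [mulAeval_C]; exact C.smul_mem c ha
  | add r s hr hs => rw [map_add]; exact add_mem hr hs
  | monomial n c h => rw [mulAeval_C_mul_X_pow_succ]; exact mul_mem ha h

variable [IsCommJordan A]

theorem commute_mul_mul_self (a : A) :
    Commute (LinearMap.mul R A a) (LinearMap.mul R A (a * a)) := by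
  ext w
  simp only [Module.End.mul_apply, LinearMap.mul_apply_apply]
  rw [mul_comm _ w, ← IsCommJordan.lmul_comm_rmul_rmul, mul_comm]

variable [IsAddTorsionFree A]

theorem mul_mul_mul_eq (a b : A) :
    LinearMap.mul R A (a * (a * b)) =
      2 • (LinearMap.mul R A (a * b) * LinearMap.mul R A a) +
        LinearMap.mul R A (a * a) * LinearMap.mul R A b -
        LinearMap.mul R A a * LinearMap.mul R A a * LinearMap.mul R A b -
        LinearMap.mul R A b * LinearMap.mul R A a * LinearMap.mul R A a := by
  ext w
  have h := jordan_linearized a w b a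
  simp only [mul_comm b a, mul_comm w b, mul_comm w a, mul_comm (a * b) a, mul_comm (a * w) a,
    mul_comm (b * w) a, mul_comm (b * w) (a * a), mul_comm (a * w) (a * b),
    mul_comm w (a * (a * b))] at h
  simp only [LinearMap.sub_apply, LinearMap.add_apply, LinearMap.smul_apply,
    Module.End.mul_apply, LinearMap.mul_apply_apply]
  linear_combination (norm := module) h

theorem commute_mul_mulAeval_X_pow {a : A} {T : Module.End R A}
    (h₁ : Commute T (LinearMap.mul R A a)) (h₂ : Commute T (LinearMap.mul R A (a * a))) :
    ∀ n : ℕ, Commute T (LinearMap.mul R A (mulAeval a (X ^ n : R[X])))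
  | 0 => by simpa [mulAeval_apply] using h₁
  | 1 => by simpa [mulAeval_apply] using h₂
  | n + 2 => by
    have ih := commute_mul_mulAeval_X_pow h₁ h₂ n
    have ih' := commute_mul_mulAeval_X_pow h₁ h₂ (n + 1)
    rw [pow_succ', mulAeval_X_mul] at ih'
    rw [pow_succ', pow_succ', mulAeval_X_mul, mulAeval_X_mul, mul_mul_mul_eq]
    exact ((((ih'.mul_right h₁).smul_right 2).add_right (h₂.mul_right ih)).sub_right
      ((h₁.mul_right h₁).mul_right ih)).sub_right ((ih.mul_right h₁).mul_right h₁)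

theorem commute_mul_mulAeval {a : A} {T : Module.End R A}
    (h₁ : Commute T (LinearMap.mul R A a)) (h₂ : Commute T (LinearMap.mul R A (a * a)))
    (r : R[X]) : Commute T (LinearMap.mul R A (mulAeval a r)) := by
  induction r using Polynomial.induction_on' with
  | add r s hr hs => rw [map_add, map_add]; exact hr.add_right hs
  | monomial n c =>
    rw [← mul_one c, ← smul_eq_mul, ← smul_monomial, monomial_one_right_eq_X_pow, map_smul,
      map_smul]
    exact (commute_mul_mulAeval_X_pow h₁ h₂ n).smul_right c

theorem commute_mul_self_mulAeval (a : A) (r : R[X]) :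
    Commute (LinearMap.mul R A a) (LinearMap.mul R A (mulAeval a r)) :=
  commute_mul_mulAeval (Commute.refl _) (commute_mul_mul_self a) r

theorem commute_mulAeval_mulAeval (a : A) (r s : R[X]) :
    Commute (LinearMap.mul R A (mulAeval a r)) (LinearMap.mul R A (mulAeval a s)) :=
  commute_mul_mulAeval (commute_mul_self_mulAeval a r).symm
    (commute_mul_mulAeval (commute_mul_mul_self a).symm (Commute.refl _) r).symm s

theorem mulAeval_mul_mulAeval (a : A) (r s : R[X]) :
    mulAeval a r * mulAeval a s = mulAeval a (s * X * r) := by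
  have h : Commute (LinearMap.mul R A (mulAeval a r)) (aeval (LinearMap.mul R A a) s) :=
    Algebra.commute_of_mem_adjoin_singleton_of_commute (aeval_mem_adjoin_singleton R _)
      (commute_mul_self_mulAeval a r).symm
  calc mulAeval a r * mulAeval a s
      = aeval (LinearMap.mul R A a) s (mulAeval a r * a) := LinearMap.congr_fun h a
    _ = mulAeval a (s * X * r) := by
        rw [mul_comm, mul_assoc, mulAeval_apply a (s * (X * r)), map_mul (aeval _) s,
          Module.End.mul_apply, ← mulAeval_apply, mulAeval_X_mul]

variable (R) in
/-- The subalgebra generated by a single element of a Jordan algebra. -/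
noncomputable def adjoinSingleton (a : A) : NonUnitalSubalgebra R A where
  __ := LinearMap.range (mulAeval (R := R) a)
  mul_mem' := by
    rintro _ _ ⟨r, rfl⟩ ⟨s, rfl⟩
    exact ⟨_, (mulAeval_mul_mulAeval a r s).symm⟩

theorem self_mem_adjoinSingleton (a : A) : a ∈ adjoinSingleton R a :=
  ⟨1, by simp [mulAeval_apply]⟩

theorem mul_assoc_of_mem_adjoinSingleton {a x y z : A} (hx : x ∈ adjoinSingleton R a)
    (hz : z ∈ adjoinSingleton R a) :
    (x * y) * z = x * (y * z) := by
  obtain ⟨r, rfl⟩ := hx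
  obtain ⟨s, rfl⟩ := hz
  rw [mul_comm, mul_comm y]
  exact LinearMap.congr_fun (commute_mulAeval_mulAeval a s r) y

end Powers

section Peirce

variable {A : Type*} [NonUnitalNonAssocCommRing A] [IsCommJordan A] [IsAddTorsionFree A]

theorem peirce_cubic {p : A} (hp : IsIdempotentElem p) (x : A) :
    2 • (p * (p * (p * x))) + p * x = 3 • (p * (p * x)) := by
  have h := jordan_linearized p p x p
  rw [hp.eq, hp.eq, mul_comm x p, mul_comm (p * x) p] at h
  linear_combination (norm := module) h

theorem two_nsmul_mul_sub_mul_mul {p : A} (hp : IsIdempotentElem p) (x : A) :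
    2 • (p * (p * x - p * (p * x))) = p * x - p * (p * x) := by
  rw [mul_sub]
  linear_combination (norm := module) -peirce_cubic hp x

theorem mul_mul_left_comm_of_mul_eq_zero {p b : A} (hp : IsIdempotentElem p) (hb : p * b = 0)
    (x : A) : p * (b * x) = b * (p * x) := by
  have h := jordan_linearized p p b x
  rw [mul_comm b p, hb, hp.eq] at h
  simpa using h.symm

theorem mul_mul_left_comm_of_mul_eq_self {p b : A} (hp : IsIdempotentElem p) (hb : p * b = b)
    (x : A) : p * (b * x) = b * (p * x) := by
  have h := jordan_linearized p p b x
  rw [mul_comm b p, hb, hp.eq] at h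
  linear_combination (norm := module) h

theorem mul_eq_zero_of_mul_eq_self_of_mul_eq_zero {p b c : A} (hp : IsIdempotentElem p)
    (hb : p * b = b) (hc : p * c = 0) : b * c = 0 := by
  calc b * c = c * (p * b) := by rw [hb, mul_comm]
    _ = p * (b * c) := by rw [← mul_mul_left_comm_of_mul_eq_zero hp hc, mul_comm b]
    _ = 0 := by rw [mul_mul_left_comm_of_mul_eq_self hp hb, hc, mul_zero]

theorem mul_mul_mul_of_two_nsmul_mul_eq_self {p b c : A} (hp : IsIdempotentElem p)
    (hb : 2 • (p * b) = b) (hc : 2 • (p * c) = c) : p * (p * (b * c)) = p * (b * c) := by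
  have half_mul {x y : A} (hx : 2 • (p * x) = x) (hy : 2 • (p * y) = y) :
      x * (p * (p * y)) = (p * x) * (p * y) := by
    calc x * (p * (p * y)) = (2 • (p * x)) * (p * (p * y)) := by rw [hx]
      _ = (p * x) * (p * (2 • (p * y))) := by simp only [smul_mul_assoc, mul_smul_comm]
      _ = (p * x) * (p * y) := by rw [hy]
  have h := jordan_linearized p b c p
  simp only [mul_comm _ p, hp.eq, half_mul hb hc, half_mul hc hb] at h
  rw [mul_comm (p * c)] at h
  linear_combination (norm := module) h

theorem mul_mul_eq_of_mul_mul_eq {p x y : A} (hp : IsIdempotentElem p)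
    (hx : p * (p * x) = p * x) (hy : p * (p * y) = p * y) : (p * x) * y = (p * x) * (p * y) := by
  have hy₀ : p * (y - p * y) = 0 := by rw [mul_sub, hy, sub_self]
  rw [← sub_eq_zero, ← mul_sub]
  exact mul_eq_zero_of_mul_eq_self_of_mul_eq_zero hp hx hy₀

theorem mul_mul_distrib_of_mul_mul_eq {p x y : A} (hp : IsIdempotentElem p)
    (hx : p * (p * x) = p * x) (hy : p * (p * y) = p * y) : p * (x * y) = (p * x) * (p * y) := by
  have hx₀ : p * (x - p * x) = 0 := by rw [mul_sub, hx, sub_self]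
  calc p * (x * y) = p * ((p * x) * y) + p * ((x - p * x) * y) := by
        rw [← mul_add, ← add_mul, add_sub_cancel]
    _ = (p * x) * (p * y) + (x - p * x) * (p * y) := by
        rw [mul_mul_left_comm_of_mul_eq_self hp hx, mul_mul_left_comm_of_mul_eq_zero hp hx₀]
    _ = (p * x) * (p * y) := by
        rw [mul_comm (x - p * x), mul_eq_zero_of_mul_eq_self_of_mul_eq_zero hp hy hx₀, add_zero]

theorem isIdempotentElem_mul_of_mul_mul_eq {p e : A} (hp : IsIdempotentElem p)
    (he : IsIdempotentElem e) (h : p * (p * e) = p * e) : IsIdempotentElem (p * e) := by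
  rw [IsIdempotentElem, ← mul_mul_distrib_of_mul_mul_eq hp h h, he.eq]

theorem mem_center_of_mul_mul_eq {p : A} (hp : IsIdempotentElem p)
    (h : ∀ x, p * (p * x) = p * x) : p ∈ Set.center A := by
  have left_assoc (x y : A) : p * (x * y) = (p * x) * y := by
    rw [mul_mul_distrib_of_mul_mul_eq hp (h x) (h y), mul_mul_eq_of_mul_mul_eq hp (h x) (h y)]
  refine ⟨fun x => mul_comm p x, left_assoc, fun x y => ?_⟩
  rw [mul_comm, mul_comm x y, left_assoc, mul_comm x, mul_comm y]

/-- The Peirce subalgebra `A₁(p) + A₀(p)` of an idempotent `p`. -/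
def peirceEven (R : Type*) [CommRing R] [Module R A] [SMulCommClass R A A] {p : A}
    (hp : IsIdempotentElem p) : NonUnitalSubalgebra R A where
  carrier := {x | p * (p * x) = p * x}
  add_mem' hx hy := by simp_all only [Set.mem_ofPred_eq, mul_add]
  zero_mem' := by simp only [Set.mem_ofPred_eq, mul_zero]
  smul_mem' c x hx := by simp_all only [Set.mem_ofPred_eq, mul_smul_comm]
  mul_mem' hx hy := by
    simp_all only [Set.mem_ofPred_eq, mul_mul_distrib_of_mul_mul_eq hp]

theorem mul_mul_sub_mul_self {p e : A} (hp : IsIdempotentElem p) (he : IsIdempotentElem e) :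
    p * (p * ((e - p) * (e - p))) = p * ((e - p) * (e - p)) := by
  simp only [mul_sub, sub_mul, he.eq, hp.eq, mul_comm e p]
  linear_combination (norm := module) -peirce_cubic hp e

end Peirce

end JordanRing

section Idempotents

variable {ι : Type*}

/-- A family of pairwise orthogonal idempotents. Unlike Mathlib's `OrthogonalIdempotents`, it does
not assume that the product is associative. -/
structure IsOrthogonalFamily {A : Type*} [Mul A] [Zero A] (e : ι → A) : Prop where
  isIdempotentElem : ∀ i, IsIdempotentElem (e i)
  mul_eq_zero : Pairwise fun i j => e i * e j = 0

variable [Fintype ι]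

namespace IsOrthogonalFamily

theorem sum_smul_mul {R A : Type*} [Semiring R] [NonUnitalNonAssocSemiring A] [Module R A]
    [IsScalarTower R A A] {e : ι → A} (he : IsOrthogonalFamily e) (f : ι → R) (i : ι) :
    (∑ j, f j • e j) * e i = f i • e i := by
  rw [Finset.sum_mul, Finset.sum_eq_single i]
  · rw [smul_mul_assoc, he.isIdempotentElem]
  · intro j _ hj
    rw [smul_mul_assoc, he.mul_eq_zero hj, smul_zero]
  · simp

theorem sum_smul_mul_sum_smul {R A : Type*} [CommSemiring R] [NonUnitalNonAssocSemiring A]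
    [Module R A] [IsScalarTower R A A] [SMulCommClass R A A] {e : ι → A}
    (he : IsOrthogonalFamily e) (f g : ι → R) :
    (∑ i, f i • e i) * (∑ i, g i • e i) = ∑ i, (f i * g i) • e i := by
  rw [Finset.mul_sum]
  simp_rw [mul_smul_comm, he.sum_smul_mul, smul_smul, mul_comm (g _)]

theorem mulAeval_sum_smul {R A : Type*} [CommRing R] [NonUnitalNonAssocCommRing A] [Module R A]
    [IsScalarTower R A A] [SMulCommClass R A A] {e : ι → A} (he : IsOrthogonalFamily e)
    (f : ι → R) (r : R[X]) :
    JordanRing.mulAeval (∑ i, f i • e i) r = ∑ i, (f i * r.eval (f i)) • e i := by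
  have eigenvector (i : ι) : LinearMap.mul R A (∑ j, f j • e j) (e i) = f i • e i :=
    he.sum_smul_mul f i
  rw [JordanRing.mulAeval_apply, map_sum]
  simp_rw [map_smul, Module.End.aeval_apply_of_mem_apply_eq_smul (eigenvector _), smul_smul]

end IsOrthogonalFamily

variable [DecidableEq ι]

/-- The product of the idempotents `q i` for `i ∈ s` and of the complementary idempotents
`1 - q i` for `i ∉ s`: an atom of the Boolean algebra generated by the `q i`. -/
def minterm {S : Type*} [CommRing S] (q : ι → S) (s : Finset ι) : S :=
  (∏ i ∈ s, q i) * ∏ i ∈ sᶜ, (1 - q i)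

section Minterm

variable {S : Type*} [CommRing S] {q : ι → S}

theorem mul_minterm_of_mem {s : Finset ι} {i : ι} (hq : IsIdempotentElem (q i)) (hi : i ∈ s) :
    q i * minterm q s = minterm q s := by
  rw [minterm, ← Finset.mul_prod_erase s q hi, ← mul_assoc, ← mul_assoc, hq.eq]

theorem mul_minterm_of_notMem {s : Finset ι} {i : ι} (hq : IsIdempotentElem (q i)) (hi : i ∉ s) :
    q i * minterm q s = 0 := by
  rw [minterm, ← Finset.mul_prod_erase sᶜ (fun j => 1 - q j) (Finset.mem_compl.2 hi),
    mul_left_comm, ← mul_assoc (q i), hq.mul_one_sub_self, zero_mul, mul_zero]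

theorem sum_minterm (q : ι → S) : ∑ s, minterm q s = 1 := by
  simp only [minterm, ← Fintype.prod_add, add_sub_cancel, Finset.prod_const_one]

theorem isOrthogonalFamily_minterm (hq : ∀ i, IsIdempotentElem (q i)) :
    IsOrthogonalFamily (minterm q) where
  isIdempotentElem s := by
    simp only [IsIdempotentElem, minterm]
    rw [mul_mul_mul_comm, ← Finset.prod_mul_distrib, ← Finset.prod_mul_distrib]
    simp only [(hq _).eq, (hq _).one_sub.eq]
  mul_eq_zero := by
    have separated {s t : Finset ι} {i : ι} (hs : i ∈ s) (ht : i ∉ t) :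
        minterm q s * minterm q t = 0 := by
      rw [← mul_minterm_of_mem (hq i) hs, mul_right_comm, mul_minterm_of_notMem (hq i) ht,
        zero_mul]
    intro s t hst
    by_cases h : s ⊆ t
    · obtain ⟨i, ht, hs⟩ := Finset.not_subset.1 fun h' => hst (h.antisymm h')
      rw [mul_comm, separated ht hs]
    · obtain ⟨i, hs, ht⟩ := Finset.not_subset.1 h
      exact separated hs ht

end Minterm

theorem exists_isOrthogonalFamily_sum_eq {B : Type*} [NonUnitalCommRing B] {q : ι → B}
    (hq : ∀ i, IsIdempotentElem (q i)) :
    ∃ e : Finset ι → B, IsOrthogonalFamily e ∧ ∀ i, q i = ∑ s, if i ∈ s then e s else 0 := by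
  have inr_inj := Unitization.inr_injective (R := ℤ) (A := B)
  let q' (i : ι) : Unitization ℤ B := q i
  have hq' (i : ι) : IsIdempotentElem (q' i) := by
    rw [IsIdempotentElem, ← Unitization.inr_mul, hq]
  have hfst {s : Finset ι} (hs : s.Nonempty) : (minterm q' s).fst = 0 := by
    obtain ⟨i, hi⟩ := hs
    rw [← mul_minterm_of_mem (hq' i) hi, Unitization.fst_mul, Unitization.fst_inr, zero_mul]
  let e (s : Finset ι) : B := if s.Nonempty then (minterm q' s).snd else 0
  have he {s : Finset ι} (hs : s.Nonempty) : (e s : Unitization ℤ B) = minterm q' s := by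
    ext <;> simp [e, hs, hfst]
  have hm := isOrthogonalFamily_minterm (q := q') hq'
  refine ⟨e, ⟨fun s => ?_, fun s t hst => ?_⟩, fun i => ?_⟩
  · rcases s.eq_empty_or_nonempty with rfl | hs
    · simp [e, IsIdempotentElem]
    · exact inr_inj (by rw [Unitization.inr_mul, he hs, hm.isIdempotentElem s])
  · rcases s.eq_empty_or_nonempty with rfl | hs
    · simp [e]
    rcases t.eq_empty_or_nonempty with rfl | ht
    · simp [e]
    exact inr_inj (by rw [Unitization.inr_mul, he hs, he ht, hm.mul_eq_zero hst,
      Unitization.inr_zero])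
  · refine inr_inj ?_
    calc q' i = ∑ s, q' i * minterm q' s := by rw [← Finset.mul_sum, sum_minterm, mul_one]
      _ = ∑ s, if i ∈ s then (e s : Unitization ℤ B) else 0 := by
        refine Finset.sum_congr rfl fun s _ => ?_
        split_ifs with hi
        · rw [mul_minterm_of_mem (hq' i) hi, he ⟨i, hi⟩]
        · rw [mul_minterm_of_notMem (hq' i) hi]
      _ = ((∑ s, if i ∈ s then e s else 0 : B) : Unitization ℤ B) := by
        rw [← Unitization.inrHom_apply ℤ ℤ B, map_sum]
        simp only [Unitization.inrHom_apply, apply_ite, Unitization.inr_zero]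

end Idempotents

namespace JBAlgebra

open JordanRing

section Norm

variable {A : Type*} [JBAlgebra A]

instance : IsScalarTower ℝ A A := ⟨fun r a b => by simpa using smul_mul r a b⟩

instance : SMulCommClass ℝ A A :=
  ⟨fun r a b => by simp only [smul_eq_mul]; rw [mul_comm a (r • b), smul_mul, mul_comm b a]⟩

instance : IsAddTorsionFree A := .of_isTorsionFree ℝ A

instance : ContinuousMul A := by
  have h : IsBoundedBilinearMap ℝ (fun x : A × A => x.1 * x.2) :=
    { add_left := fun _ _ _ => add_mul _ _ _
      smul_left := fun _ _ _ => smul_mul_assoc _ _ _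
      add_right := fun _ _ _ => mul_add _ _ _
      smul_right := fun _ _ _ => mul_smul_comm _ _ _
      bound := ⟨1, one_pos, fun x y => by simpa using norm_mul_le' x y⟩ }
  exact ⟨h.continuous⟩

theorem eq_zero_of_mul_self {a : A} (h : a * a = 0) : a = 0 := by
  rw [← norm_eq_zero, ← sq_eq_zero_iff, ← norm_sq, h, norm_zero]

theorem eq_zero_of_mul_mul_self {a : A} (h : a * (a * a) = 0) : a = 0 := by
  refine eq_zero_of_mul_self (eq_zero_of_mul_self ?_)
  rw [IsCommJordan.lmul_comm_rmul_rmul, h, mul_zero]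

theorem norm_le_one_of_isIdempotentElem {p : A} (hp : IsIdempotentElem p) : ‖p‖ ≤ 1 := by
  have h := norm_sq p
  rw [hp] at h
  nlinarith [norm_nonneg p]

theorem one_le_norm_of_isIdempotentElem {p : A} (hp : IsIdempotentElem p) (hp₀ : p ≠ 0) :
    1 ≤ ‖p‖ := by
  have h := norm_sq p
  rw [hp] at h
  nlinarith [norm_pos_iff.2 hp₀]

theorem continuous_mulAeval (r : ℝ[X]) : Continuous fun a : A => mulAeval a r := by
  induction r using Polynomial.induction_on with
  | C c => simp only [mulAeval_C]; exact continuous_const_smul c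
  | add r s hr hs => simp only [map_add]; exact hr.add hs
  | monomial n c h => simp only [mulAeval_C_mul_X_pow_succ]; exact continuous_id.mul h

section OrthogonalFamily

variable {ι : Type*} [Fintype ι] {e : ι → A}

theorem norm_sum_smul_pow_two_pow (he : IsOrthogonalFamily e) (f : ι → ℝ) (n : ℕ) :
    ‖∑ i, f i • e i‖ ^ 2 ^ n = ‖∑ i, (f i ^ 2 ^ n) • e i‖ := by
  induction n with
  | zero => simp
  | succ n ih =>
    rw [pow_succ, pow_mul, ih, ← norm_sq, he.sum_smul_mul_sum_smul]
    simp_rw [← pow_add, ← mul_two]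

-- Compare `2ⁿ`-th powers: the triangle inequality loses only a factor `card ι`, uniformly in `n`.
theorem norm_sum_smul_le (he : IsOrthogonalFamily e) {f : ι → ℝ} {M : ℝ} (hM : 0 ≤ M)
    (hf : ∀ i, e i ≠ 0 → |f i| ≤ M) : ‖∑ i, f i • e i‖ ≤ M := by
  have term_le (n : ℕ) (i : ι) : ‖(f i ^ 2 ^ n) • e i‖ ≤ M ^ 2 ^ n := by
    by_cases hi : e i = 0
    · simp [hi, pow_nonneg hM]
    · calc ‖(f i ^ 2 ^ n) • e i‖ = |f i| ^ 2 ^ n * ‖e i‖ := by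
            rw [norm_smul, norm_pow, Real.norm_eq_abs]
        _ ≤ M ^ 2 ^ n * 1 := by
            gcongr
            · exact hf i hi
            · exact norm_le_one_of_isIdempotentElem (he.isIdempotentElem i)
        _ = M ^ 2 ^ n := mul_one _
  have pow_le (n : ℕ) : ‖∑ i, f i • e i‖ ^ 2 ^ n ≤ Fintype.card ι * M ^ 2 ^ n := by
    rw [norm_sum_smul_pow_two_pow he]
    simpa using norm_sum_le_of_le Finset.univ fun i _ => term_le n i
  refine le_of_forall_gt_imp_ge_of_dense fun N hN => ?_
  have hN₀ : 0 < N := hM.trans_lt hN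
  by_contra! hlt
  obtain ⟨n, hn⟩ := pow_unbounded_of_one_lt (Fintype.card ι : ℝ) ((one_lt_div hN₀).2 hlt)
  have h := hn.trans_le
    (pow_le_pow_right₀ ((one_lt_div hN₀).2 hlt).le n.lt_two_pow_self.le)
  rw [div_pow, lt_div_iff₀ (by positivity)] at h
  refine absurd h (not_lt.2 ((pow_le n).trans ?_))
  gcongr

theorem abs_le_norm_sum_smul (he : IsOrthogonalFamily e) (f : ι → ℝ) {i : ι} (hi : e i ≠ 0) :
    |f i| ≤ ‖∑ j, f j • e j‖ := by
  have hle := norm_mul_le' (∑ j, f j • e j) (e i)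
  rw [he.sum_smul_mul, norm_smul, Real.norm_eq_abs] at hle
  exact le_of_mul_le_mul_right hle (norm_pos_iff.2 hi)

end OrthogonalFamily

end Norm

section Associative

variable {A : Type*} [JBAlgebra A] {B : NonUnitalSubalgebra ℝ A}

/-- An associative subalgebra of a JB-algebra as a commutative associative ring. -/
abbrev IsAssociative.nonUnitalCommRing (hB : IsAssociative B) : NonUnitalCommRing B where
  __ := (inferInstance : NonUnitalNonAssocRing B)
  mul_assoc x y z := Subtype.ext (hB x x.2 y y.2 z z.2)
  mul_comm x y := Subtype.ext (mul_comm (x : A) y)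

theorem IsAssociative.mul_mem_projections (hB : IsAssociative B) {p q : A}
    (hp : p ∈ (B : Set A) ∩ projections A) (hq : q ∈ (B : Set A) ∩ projections A) :
    p * q ∈ (B : Set A) ∩ projections A := by
  let _ := hB.nonUnitalCommRing
  have hp' : IsIdempotentElem (⟨p, hp.1⟩ : B) := Subtype.ext hp.2
  have hq' : IsIdempotentElem (⟨q, hq.1⟩ : B) := Subtype.ext hq.2
  exact ⟨mul_mem hp.1 hq.1, congrArg Subtype.val (hp'.mul hq')⟩

theorem IsAssociative.U_eq (hB : IsAssociative B) {x y : A} (hx : x ∈ B) (hy : y ∈ B) :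
    U x y = x * x * y := by
  rw [U, ← hB x hx x hx y hy]
  module

theorem isAssociative_adjoinSingleton (a : A) : IsAssociative (adjoinSingleton ℝ a) :=
  fun _ hx _ _ _ hz => mul_assoc_of_mem_adjoinSingleton hx hz

theorem isAssociative_sSup {c : Set (NonUnitalSubalgebra ℝ A)} (hc : ∀ C ∈ c, IsAssociative C)
    (hdir : DirectedOn (· ≤ ·) c) (hne : c.Nonempty) : IsAssociative (sSup c) := by
  have mem_sSup (x : A) : x ∈ sSup c ↔ ∃ C ∈ c, x ∈ C := by
    have := hne.to_subtype
    rw [sSup_eq_iSup', ← SetLike.mem_coe,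
      NonUnitalSubalgebra.coe_iSup_of_directed hdir.directed_val]
    simp
  intro x hx y hy z hz
  obtain ⟨C₁, h₁, hx⟩ := (mem_sSup x).1 hx
  obtain ⟨C₂, h₂, hy⟩ := (mem_sSup y).1 hy
  obtain ⟨C₃, h₃, hz⟩ := (mem_sSup z).1 hz
  obtain ⟨C₁₂, h₁₂, hle₁, hle₂⟩ := hdir C₁ h₁ C₂ h₂
  obtain ⟨C, hC, hle₁₂, hle₃⟩ := hdir C₁₂ h₁₂ C₃ h₃
  exact hc C hC x (hle₁₂ (hle₁ hx)) y (hle₁₂ (hle₂ hy)) z (hle₃ hz)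

theorem exists_maximal_isAssociative (a : A) :
    ∃ B : NonUnitalSubalgebra ℝ A, a ∈ B ∧ Maximal IsAssociative B := by
  obtain ⟨B, hle, hB⟩ := zorn_le_nonempty₀ {B : NonUnitalSubalgebra ℝ A | IsAssociative B}
    (fun c hc hchain C hC =>
      ⟨sSup c, isAssociative_sSup (fun _ h => hc h) hchain.directedOn ⟨C, hC⟩, fun _ => le_sSup⟩)
    (adjoinSingleton ℝ a) (isAssociative_adjoinSingleton a)
  exact ⟨B, hle (self_mem_adjoinSingleton a), hB⟩

/-- The closed linear span of the projections of an associative subalgebra `B`, which is a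
subalgebra because `B ∩ P(A)` is closed under products. -/
def IsAssociative.projectionSpanClosure (hB : IsAssociative B) : NonUnitalSubalgebra ℝ A where
  toSubmodule := (Submodule.span ℝ ((B : Set A) ∩ projections A)).topologicalClosure
  mul_mem' hx hy := map_mem_closure₂ continuous_mul hx hy fun x hx y hy =>
    LinearMap.BilinMap.apply_apply_mem_of_mem_span _ _ _ (LinearMap.mul ℝ A)
      (fun _ hp _ hq => Submodule.subset_span (hB.mul_mem_projections hp hq)) x y hx hy

end Associative

section Spectral

variable {A : Type*} [JBAlgebra A] {B : NonUnitalSubalgebra ℝ A}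

/-- `x` is a finite real combination of pairwise orthogonal projections in `B`. -/
def IsSpectralSum (B : NonUnitalSubalgebra ℝ A) (x : A) : Prop :=
  ∃ (ι : Type) (_ : Fintype ι) (e : ι → A) (f : ι → ℝ),
    IsOrthogonalFamily e ∧ (∀ i, e i ∈ B) ∧ x = ∑ i, f i • e i

theorem isSpectralSum_of_mem_span (hB : IsAssociative B) {x : A}
    (hx : x ∈ Submodule.span ℝ ((B : Set A) ∩ projections A)) : IsSpectralSum B x := by
  classical
  let _ := hB.nonUnitalCommRing
  obtain ⟨n, c, p, rfl⟩ := Submodule.mem_span_set'.1 hx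
  let q (i : Fin n) : B := ⟨p i, (p i).2.1⟩
  obtain ⟨e, he, hq⟩ :=
    exists_isOrthogonalFamily_sum_eq (q := q) fun i => Subtype.ext (p i).2.2
  have hp (i : Fin n) : (p i : A) = ∑ s, if i ∈ s then (e s : A) else 0 := by
    have h := congrArg Subtype.val (hq i)
    rw [AddSubmonoidClass.coe_finsetSum] at h
    simpa only [apply_ite Subtype.val, ZeroMemClass.coe_zero] using h
  refine ⟨Finset (Fin n), inferInstance, fun s => e s, fun s => ∑ i ∈ s, c i,
    ⟨fun s => congrArg Subtype.val (he.isIdempotentElem s),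
      fun s t hst => congrArg Subtype.val (he.mul_eq_zero hst)⟩, fun s => (e s).2, ?_⟩
  simp_rw [hp, Finset.smul_sum, Finset.sum_smul]
  rw [Finset.sum_comm]
  simp only [smul_ite, smul_zero, Finset.sum_ite_mem, Finset.univ_inter]

theorem mem_closure_isSpectralSum [IsAJWAlgebra A] (hB : Maximal IsAssociative B) {x : A}
    (hx : x ∈ B) : x ∈ closure {s | IsSpectralSum B s} := by
  have hle : B ≤ hB.prop.projectionSpanClosure := (IsAJWAlgebra.generated B hB).2
    ⟨isClosed_closure, fun p hp => subset_closure (Submodule.subset_span hp)⟩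
  exact closure_mono (fun _ => isSpectralSum_of_mem_span hB.prop) (hle hx)

theorem IsSpectralSum.exists_approx_support {s : A} (hs : IsSpectralSum B s) {δ : ℝ}
    (hδ : 0 < δ) :
    ∃ f ∈ B, ∃ u ∈ B, IsIdempotentElem f ∧ s * u = f ∧ ‖u‖ ≤ δ⁻¹ ∧ ‖s - s * f‖ ≤ δ := by
  classical
  obtain ⟨ι, _, e, l, he, heB, rfl⟩ := hs
  have sum_mem_B (c : ι → ℝ) : ∑ i, c i • e i ∈ B := sum_mem fun i _ => B.smul_mem _ (heB i)
  let χ (i : ι) : ℝ := if δ < |l i| then 1 else 0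
  refine ⟨∑ i, χ i • e i, sum_mem_B _, ∑ i, (χ i * (l i)⁻¹) • e i, sum_mem_B _, ?_, ?_, ?_, ?_⟩
  · rw [IsIdempotentElem, he.sum_smul_mul_sum_smul]
    simp [χ, ← ite_and]
  · rw [he.sum_smul_mul_sum_smul]
    refine Finset.sum_congr rfl fun i _ => ?_
    by_cases hi : δ < |l i|
    · have hl : l i ≠ 0 := abs_pos.1 (hδ.trans hi)
      simp [χ, hi, hl]
    · simp [χ, hi]
  · refine norm_sum_smul_le he (by positivity) fun i _ => ?_
    by_cases hi : δ < |l i|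
    · simpa [χ, hi] using inv_anti₀ hδ hi.le
    · simpa [χ, hi] using hδ.le
  · rw [he.sum_smul_mul_sum_smul, ← Finset.sum_sub_distrib]
    simp_rw [← sub_smul]
    refine norm_sum_smul_le he hδ.le fun i _ => ?_
    by_cases hi : δ < |l i|
    · simpa [χ, hi] using hδ.le
    · simpa [χ, hi] using not_lt.1 hi

-- `u` inverts `x` on `f` up to an error of norm less than one, whose powers tend to zero.
theorem mem_closure_mul_image (hB : IsAssociative B) {x f u : A} (hx : x ∈ B) (hf : f ∈ B)
    (hu : u ∈ B) (hff : IsIdempotentElem f) (h : ‖f - x * u‖ < 1) :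
    f ∈ closure ((x * ·) '' (B : Set A)) := by
  let _ := hB.nonUnitalCommRing
  have improve {y : A} (hy : y ∈ B) :
      ∃ z ∈ B, f - x * z = (f - x * y) * (f - x * u) := by
    let x' : B := ⟨x, hx⟩
    let f' : B := ⟨f, hf⟩
    let u' : B := ⟨u, hu⟩
    let y' : B := ⟨y, hy⟩
    have hff' : f' * f' = f' := Subtype.ext hff
    have expand : f' - x' * (u' * f' + y' * f' - y' * (x' * u')) =
        (f' - x' * y') * (f' - x' * u') := by
      simp only [mul_sub, sub_mul, mul_add, hff', mul_comm f', mul_assoc]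
      abel
    exact ⟨_, (u' * f' + y' * f' - y' * (x' * u')).2, congrArg Subtype.val expand⟩
  have approx (n : ℕ) : ∃ y ∈ B, ‖f - x * y‖ ≤ ‖f - x * u‖ ^ (n + 1) := by
    induction n with
    | zero => exact ⟨u, hu, by simp⟩
    | succ n ih =>
      obtain ⟨y, hy, hn⟩ := ih
      obtain ⟨z, hz, hzy⟩ := improve hy
      refine ⟨z, hz, ?_⟩
      rw [hzy, pow_succ]
      exact (norm_mul_le' _ _).trans (by gcongr)
  refine Metric.mem_closure_iff.2 fun δ hδ => ?_
  obtain ⟨n, hn⟩ := exists_pow_lt_of_lt_one hδ h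
  obtain ⟨y, hy, hle⟩ := approx n
  refine ⟨x * y, ⟨y, hy, rfl⟩, ?_⟩
  rw [dist_eq_norm]
  exact (hle.trans (pow_le_pow_of_le_one (norm_nonneg _) h.le n.le_succ)).trans_lt hn

theorem mem_closure_range_U (hB : IsAssociative B) {x f : A} (hx : x ∈ B)
    (hff : IsIdempotentElem f) (h : f ∈ closure ((x * ·) '' (B : Set A))) :
    f ∈ closure (Set.range (U x)) := by
  let _ := hB.nonUnitalCommRing
  have hsq : Continuous fun v : A => v * v := continuous_id.mul continuous_id
  have sq_mem : Set.MapsTo (fun v : A => v * v) ((x * ·) '' (B : Set A)) (Set.range (U x)) := by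
    rintro _ ⟨y, hy, rfl⟩
    refine ⟨y * y, ?_⟩
    rw [hB.U_eq hx (mul_mem hy hy)]
    exact congrArg Subtype.val (mul_mul_mul_comm (⟨x, hx⟩ : B) ⟨x, hx⟩ ⟨y, hy⟩ ⟨y, hy⟩)
  simpa only [hff.eq] using map_mem_closure hsq h sq_mem

theorem exists_isIdempotentElem_near [IsAJWAlgebra A] (x : A) {ε : ℝ} (hε : 0 < ε) :
    ∃ f : A, IsIdempotentElem f ∧ f ∈ closure (Set.range (U x)) ∧ ‖x - U f x‖ ≤ ε := by
  obtain ⟨B, hxB, hB⟩ := exists_maximal_isAssociative x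
  obtain ⟨s, hs, hxs⟩ :=
    Metric.mem_closure_iff.1 (mem_closure_isSpectralSum hB hxB) (ε / 4) (by positivity)
  obtain ⟨f, hfB, u, huB, hff, hsu, hu, hsf⟩ := hs.exists_approx_support (half_pos hε)
  have mul_norm_le {v : A} {c : ℝ} (hv : ‖v‖ ≤ c) : ‖(s - x) * v‖ ≤ ε / 4 * c := by
    rw [dist_eq_norm, norm_sub_rev] at hxs
    exact (norm_mul_le' _ _).trans (by gcongr)
  have hfu : ‖f - x * u‖ < 1 := by
    rw [← hsu, ← sub_mul]
    calc ‖(s - x) * u‖ ≤ ε / 4 * (ε / 2)⁻¹ := mul_norm_le hu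
      _ < 1 := by field_simp; norm_num
  refine ⟨f, hff, mem_closure_range_U hB.prop hxB hff
    (mem_closure_mul_image hB.prop hxB hfB huB hff hfu), ?_⟩
  calc ‖x - U f x‖ = ‖(x - s) + (s - s * f) + (s - x) * f‖ := by
        rw [hB.prop.U_eq hfB hxB, hff.eq, mul_comm f, sub_mul]
        abel_nf
    _ ≤ ‖x - s‖ + ‖s - s * f‖ + ‖(s - x) * f‖ := norm_add₃_le
    _ ≤ ε / 4 + ε / 2 + ε / 4 * 1 := by
        gcongr
        · exact (dist_eq_norm x s ▸ hxs).le
        · exact mul_norm_le (norm_le_one_of_isIdempotentElem hff)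
    _ = ε := by ring

end Spectral

section SquareRoot

theorem exists_polynomial_abs_sub_sq_mul_eval_sq_le (K : ℝ) {ε : ℝ} (hε : 0 < ε) :
    ∃ r : ℝ[X], ∀ t ∈ Set.Icc 0 K, |t - t * t * r.eval (t * t)| ≤ ε := by
  obtain ⟨P, hP⟩ := exists_polynomial_near_of_continuousOn 0 (K * K) Real.sqrt
    Real.continuous_sqrt.continuousOn (ε / 2) (half_pos hε)
  refine ⟨P.divX, fun t ht => ?_⟩
  have h₀ := hP 0 ⟨le_rfl, mul_self_nonneg K⟩
  have h := hP (t * t) ⟨mul_self_nonneg t, mul_self_le_mul_self ht.1 ht.2⟩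
  have hdivX := congrArg (eval (t * t)) P.divX_mul_X_add
  rw [eval_add, eval_mul, eval_X, eval_C, coeff_zero_eq_eval_zero] at hdivX
  rw [Real.sqrt_zero, sub_zero] at h₀
  rw [Real.sqrt_mul_self ht.1] at h
  rw [abs_lt] at h h₀
  rw [abs_le]
  constructor <;> linarith

variable {A : Type*} [JBAlgebra A]

theorem IsSpectralSum.norm_mul_self_sub_mulAeval_le {B : NonUnitalSubalgebra ℝ A} {s : A}
    (hs : IsSpectralSum B s) {K ε : ℝ} (hK : ‖s * s‖ ≤ K) (hε : 0 ≤ ε) {r : ℝ[X]}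
    (hr : ∀ t ∈ Set.Icc 0 K, |t - t * t * r.eval (t * t)| ≤ ε) :
    ‖s * s - mulAeval ((s * s) * (s * s)) r‖ ≤ ε := by
  obtain ⟨ι, _, e, l, he, -, rfl⟩ := hs
  rw [he.sum_smul_mul_sum_smul] at hK ⊢
  rw [he.sum_smul_mul_sum_smul, he.mulAeval_sum_smul, ← Finset.sum_sub_distrib]
  simp_rw [← sub_smul]
  exact norm_sum_smul_le he hε fun i hi => hr _
    ⟨mul_self_nonneg _, (le_abs_self _).trans ((abs_le_norm_sum_smul he _ hi).trans hK)⟩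

variable [IsAJWAlgebra A]

theorem exists_norm_mul_self_sub_mulAeval_le (a : A) {ε : ℝ} (hε : 0 < ε) :
    ∃ r : ℝ[X], ‖a * a - mulAeval ((a * a) * (a * a)) r‖ ≤ ε := by
  obtain ⟨B, haB, hB⟩ := exists_maximal_isAssociative a
  have hsq : Continuous fun b : A => b * b := continuous_id.mul continuous_id
  obtain ⟨r, hr⟩ := exists_polynomial_abs_sub_sq_mul_eval_sq_le (‖a * a‖ + 1) hε
  have hclosed : IsClosed {b : A | ‖b * b - mulAeval ((b * b) * (b * b)) r‖ ≤ ε} :=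
    isClosed_le (hsq.sub ((continuous_mulAeval r).comp (hsq.mul hsq))).norm continuous_const
  have hopen : IsOpen {b : A | ‖b * b‖ < ‖a * a‖ + 1} := isOpen_lt hsq.norm continuous_const
  exact ⟨r, closure_minimal (fun s hs => hs.2.norm_mul_self_sub_mulAeval_le hs.1.le hε.le hr)
    hclosed (hopen.inter_closure ⟨lt_add_one ‖a * a‖, mem_closure_isSpectralSum hB haB⟩)⟩

theorem mul_self_mem_of_mul_self_mul_mul_self_mem {C : NonUnitalSubalgebra ℝ A}
    (hC : IsClosed (C : Set A)) {a : A} (h : (a * a) * (a * a) ∈ C) : a * a ∈ C := by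
  refine hC.closure_subset (Metric.mem_closure_iff.2 fun ε hε => ?_)
  obtain ⟨r, hr⟩ := exists_norm_mul_self_sub_mulAeval_le a (half_pos hε)
  exact ⟨_, mulAeval_mem h r, by rw [dist_eq_norm]; linarith⟩

end SquareRoot

section Order

variable {A : Type*} [JBAlgebra A]

theorem norm_le_of_le {x y : A} (hx : x ∈ posCone A) (h : Le x y) : ‖x‖ ≤ ‖y‖ := by
  obtain ⟨a, rfl⟩ := hx
  obtain ⟨b, hb⟩ := h
  simpa [← hb] using norm_sq_le a b

theorem smul_mem_posCone {p : A} (hp : IsIdempotentElem p) {c : ℝ} (hc : 0 ≤ c) :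
    c • p ∈ posCone A :=
  ⟨√c • p, by rw [smul_mul_smul_comm, hp, Real.mul_self_sqrt hc]⟩

theorem eq_zero_of_two_smul_le {p e : A} (hp : IsIdempotentElem p) (he : IsIdempotentElem e)
    (h : Le ((2 : ℝ) • p) e) : p = 0 := by
  by_contra hp₀
  have hle := norm_le_of_le (smul_mem_posCone hp zero_le_two) h
  rw [norm_smul, Real.norm_ofNat] at hle
  linarith [one_le_norm_of_isIdempotentElem hp hp₀, norm_le_one_of_isIdempotentElem he]

variable [IsAJWAlgebra A]

theorem mul_mul_eq_of_le {p e : A} (hp : IsIdempotentElem p) (he : IsIdempotentElem e)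
    (h : Le p e) : p * (p * e) = p * e := by
  obtain ⟨a, ha⟩ := h
  have hclosed : IsClosed (peirceEven ℝ hp : Set A) :=
    isClosed_eq (continuous_const.mul (continuous_const.mul continuous_id))
      (continuous_const.mul continuous_id)
  have hsq : (a * a) * (a * a) ∈ peirceEven ℝ hp := ha ▸ mul_mul_sub_mul_self hp he
  have heven : p * (p * (e - p)) = p * (e - p) :=
    ha ▸ mul_self_mem_of_mul_self_mul_mul_self_mem hclosed hsq
  simpa only [mul_sub, hp.eq, sub_left_inj] using heven

theorem mul_eq_of_le {p e : A} (hp : IsIdempotentElem p) (he : IsIdempotentElem e)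
    (h : Le p e) : p * e = p := by
  have heven : p * (p * e) = p * e := mul_mul_eq_of_le hp he h
  have hpe : IsIdempotentElem (p * e) := isIdempotentElem_mul_of_mul_mul_eq hp he heven
  have hpee : (p * e) * e = p * e := by rw [mul_mul_eq_of_mul_mul_eq hp heven heven, hpe.eq]
  have hr : IsIdempotentElem (p - p * e) := hpe.sub hp (by rw [mul_comm, heven]) heven
  have hs : IsIdempotentElem (e - p * e) := hpe.sub he hpee (by rw [mul_comm, hpee])
  have hrs : (p - p * e) * (e - p * e) = 0 := by
    simp only [sub_mul, mul_sub, hpee, heven, hpe.eq, sub_self]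
  have hsum : IsIdempotentElem ((p - p * e) + (e - p * e)) :=
    hr.add hs (by rw [mul_comm (e - p * e), hrs, add_zero])
  have hle : Le ((2 : ℝ) • (p - p * e)) ((p - p * e) + (e - p * e)) := by
    obtain ⟨a, ha⟩ := h
    exact ⟨a, by rw [← ha]; module⟩
  exact (sub_eq_zero.1 (eq_zero_of_two_smul_le hr hsum hle)).symm

end Order

section Annihilator

variable {A : Type*} [JBAlgebra A]

theorem eq_zero_of_two_nsmul_mul_eq_self_of_mul_mul_self_eq_zero {p z : A}
    (hz : 2 • (p * z) = z) (h : p * (z * z) = 0) : z = 0 := by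
  refine eq_zero_of_mul_mul_self ?_
  calc z * (z * z) = 2 • ((z * p) * (z * z)) := by rw [← smul_mul_assoc, mul_comm z p, hz]
    _ = 0 := by rw [IsCommJordan.lmul_comm_rmul_rmul, h, mul_zero, smul_zero]

theorem eq_zero_of_two_nsmul_mul_eq_self_of_mul_mul_self_eq_self {p z : A}
    (hz : 2 • (p * z) = z) (h : p * (z * z) = z * z) : z = 0 := by
  refine eq_zero_of_mul_mul_self ?_
  have hcube : z * (z * z) = 2 • (z * (z * z)) := by
    calc z * (z * z) = 2 • ((z * p) * (z * z)) := by rw [← smul_mul_assoc, mul_comm z p, hz]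
      _ = 2 • (z * (z * z)) := by rw [IsCommJordan.lmul_comm_rmul_rmul, h]
  rwa [two_nsmul, left_eq_add] at hcube

theorem mul_U_eq_zero {p x : A} (hp : IsIdempotentElem p) (hx : p * x = 0) (y : A) :
    p * U x y = 0 := by
  have hxx : p * (x * x) = 0 := by rw [mul_mul_left_comm_of_mul_eq_zero hp hx, hx, mul_zero]
  have h := jordan_linearized x p y x
  rw [mul_comm x p, hx, mul_comm (p * y) x, mul_comm (y * x) x, mul_comm y x] at h
  simp only [zero_mul, mul_zero, add_zero, mul_mul_left_comm_of_mul_eq_zero hp hx] at h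
  rw [mul_comm (p * y)] at h
  rw [U, mul_sub, mul_smul_comm, mul_mul_left_comm_of_mul_eq_zero hp hx,
    mul_mul_left_comm_of_mul_eq_zero hp hx, mul_mul_left_comm_of_mul_eq_zero hp hxx, ← h]
  module

theorem mul_eq_zero_of_mem_closure_range_U {p x f : A} (hp : IsIdempotentElem p)
    (hx : p * x = 0) (hf : f ∈ closure (Set.range (U x))) : p * f = 0 := by
  have hclosed : IsClosed {v : A | p * v = 0} :=
    isClosed_eq (continuous_const.mul continuous_id) continuous_const
  refine closure_minimal ?_ hclosed hf
  rintro _ ⟨y, rfl⟩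
  exact mul_U_eq_zero hp hx y

theorem U_eq_zero_of_mul_eq_self_of_mul_eq_zero {p b c : A} (hp : IsIdempotentElem p)
    (hb : p * b = b) (hc : p * c = 0) : U b c = 0 := by
  have hbb : p * (b * b) = b * b := by rw [mul_mul_left_comm_of_mul_eq_self hp hb, hb]
  simp [U, mul_eq_zero_of_mul_eq_self_of_mul_eq_zero hp hb hc,
    mul_eq_zero_of_mul_eq_self_of_mul_eq_zero hp hbb hc]

theorem U_eq_zero_of_mul_eq_zero_of_mul_eq_self {p b c : A} (hp : IsIdempotentElem p)
    (hb : p * b = 0) (hc : p * c = c) : U b c = 0 := by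
  have hbb : p * (b * b) = 0 := by rw [mul_mul_left_comm_of_mul_eq_zero hp hb, hb, mul_zero]
  simp [U, mul_comm _ c, mul_eq_zero_of_mul_eq_self_of_mul_eq_zero hp hc hb,
    mul_eq_zero_of_mul_eq_self_of_mul_eq_zero hp hc hbb]

theorem mul_eq_zero_of_U_eq_zero {p x : A} (hp : IsIdempotentElem p) (h₁ : U p x = 0)
    (h₂ : U (p * x) x = 0) (h₃ : U (p + p * x) x = 0) : p * x = 0 := by
  have hhalf : 2 • (p * (p * x)) = p * x := by
    rw [U, hp.eq] at h₁
    linear_combination (norm := module) h₁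
  have hx₀ : p * (x - 2 • (p * x)) = 0 := by rw [mul_sub, mul_smul_comm, hhalf, sub_self]
  have hcomm := mul_mul_left_comm_of_mul_eq_zero hp hx₀ (p * x)
  have hhalf' : p * (p * x) = (1 / 2 : ℝ) • (p * x) := by
    linear_combination (norm := module) (1 / 2 : ℝ) • hhalf
  refine eq_zero_of_two_nsmul_mul_eq_self_of_mul_mul_self_eq_zero hhalf ?_
  simp only [U] at h₂ h₃
  simp only [mul_add, add_mul, hp.eq, mul_comm (p * x) p, hhalf', smul_mul_assoc] at h₂ h₃
  simp only [sub_mul, mul_sub, mul_smul_comm, smul_mul_assoc, hhalf', mul_comm x (p * x)] at hcomm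
  linear_combination (norm := module) (1 / 4 : ℝ) • (h₃ - h₂) - (1 / 2 : ℝ) • hcomm

theorem annPos_setOf_mul_eq_zero {u g : A} (hu : ∀ x, u * x = x) (hg : IsIdempotentElem g)
    (hcenter : g ∈ Set.center A) :
    annPos {x | x ∈ posCone A ∧ g * x = 0} = {x | ∃ a ∈ posCone A, x = g * a} := by
  have mul_mul (x : A) : g * (g * x) = g * x := by rw [hcenter.left_assoc, hg.eq]
  ext x
  constructor
  · rintro ⟨hx, hU⟩
    have mul_u : g * u = g := by rw [mul_comm, hu]
    have hug : IsIdempotentElem (u - g) := hg.sub (hu u) mul_u (hu g)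
    have h := hU (u - g) ⟨⟨u - g, hug.eq.symm⟩, by rw [mul_sub, mul_u, hg.eq, sub_self]⟩
    rw [U, hug.eq] at h
    simp only [sub_mul, mul_sub, hu, mul_mul] at h
    exact ⟨x, hx, by linear_combination (norm := module) h⟩
  · rintro ⟨_, ⟨a, rfl⟩, rfl⟩
    refine ⟨⟨g * a, ?_⟩, fun b hb => ?_⟩
    · exact mul_mul_distrib_of_mul_mul_eq hg (mul_mul a) (mul_mul a)
    · exact U_eq_zero_of_mul_eq_zero_of_mul_eq_self hg hb.2 (mul_mul _)

end Annihilator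

section Ideal

variable {A : Type*} [JBAlgebra A]

theorem exists_maximal_pairwise_mul_eq_zero (T : Set A) :
    ∃ S, Maximal (fun S : Set A => S ⊆ T ∧ S.Pairwise fun p q => p * q = 0) S :=
  zorn_subset {S : Set A | S ⊆ T ∧ S.Pairwise fun p q => p * q = 0} fun c hc hchain =>
    ⟨⋃₀ c, ⟨Set.sUnion_subset fun _ hs => (hc hs).1,
      (Set.pairwise_sUnion hchain.directedOn).2 fun _ hs => (hc hs).2⟩,
      fun _ => Set.subset_sUnion_of_mem⟩

theorem IsIdeal.U_mem {I : Submodule ℝ A} (hI : IsIdeal I) {x : A} (hx : x ∈ I) (y : A) :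
    U x y ∈ I := by
  rw [U, mul_comm x y, mul_comm (x * x)]
  exact I.sub_mem (I.smul_mem _ (mul_comm x (y * x) ▸ hI _ _ hx)) (hI _ _ (hI _ _ hx))

theorem IsIdeal.mul_eq_self_of_eq_zero_of_mul_eq_zero {I : Submodule ℝ A} (hI : IsIdeal I)
    {g : A} (hg : IsIdempotentElem g) (h : ∀ x ∈ I, g * x = 0 → x = 0) {x : A} (hx : x ∈ I) :
    g * x = x := by
  have peirce_zero_eq_zero {y : A} (hy : y ∈ I) : y - 3 • (g * y) + 2 • (g * (g * y)) = 0 := by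
    have hgy : g * y ∈ I := hI g y hy
    refine h _ (I.add_mem (I.sub_mem hy (I.nsmul_mem hgy 3)) (I.nsmul_mem (hI g _ hgy) 2)) ?_
    simp only [mul_add, mul_sub, mul_smul_comm]
    linear_combination (norm := module) peirce_cubic hg y
  have hz : 2 • (g * (g * x - g * (g * x))) = g * x - g * (g * x) :=
    two_nsmul_mul_sub_mul_mul hg x
  set z := g * x - g * (g * x) with hz_def
  have hzI : z ∈ I := I.sub_mem (hI g x hx) (hI g _ (hI g x hx))
  have hz₀ : z = 0 := by
    refine eq_zero_of_two_nsmul_mul_eq_self_of_mul_mul_self_eq_self hz ?_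
    have hzz := peirce_zero_eq_zero (hI z z hzI)
    rw [mul_mul_mul_of_two_nsmul_mul_eq_self hg hz hz] at hzz
    linear_combination (norm := module) -hzz
  linear_combination (norm := module) -peirce_zero_eq_zero hx - 2 • (hz_def.symm.trans hz₀)

variable [IsAJWAlgebra A]

theorem IsIdeal.exists_isIdempotentElem_mem {I : Submodule ℝ A} (hI : IsIdeal I)
    (hclosed : IsClosed (I : Set A)) {x : A} (hx : x ∈ I) (hx₀ : x ≠ 0) :
    ∃ f ∈ I, IsIdempotentElem f ∧ f ≠ 0 ∧ ∀ p, IsIdempotentElem p → p * x = 0 → p * f = 0 := by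
  have hpos : 0 < ‖x‖ := norm_pos_iff.2 hx₀
  obtain ⟨f, hf, hfx, hnear⟩ := exists_isIdempotentElem_near x (half_pos hpos)
  refine ⟨f, ?_, hf, ?_, fun p hp hpx => mul_eq_zero_of_mem_closure_range_U hp hpx hfx⟩
  · exact closure_minimal (Set.range_subset_iff.2 (hI.U_mem hx)) hclosed hfx
  · rintro rfl
    simp only [U, zero_mul, smul_zero, sub_zero] at hnear
    linarith

theorem IsIdeal.eq_zero_of_isProjectionLUB_mul_eq_zero {I : Submodule ℝ A} (hI : IsIdeal I)
    (hclosed : IsClosed (I : Set A)) {S : Set A}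
    (hS : Maximal (fun S : Set A => S ⊆ I ∩ projections A ∧ S.Pairwise fun p q => p * q = 0) S)
    {g : A} (hg : IsProjectionLUB S g) {x : A} (hx : x ∈ I) (hgx : g * x = 0) : x = 0 := by
  by_contra hx₀
  obtain ⟨f, hfI, hf, hf₀, horth⟩ := hI.exists_isIdempotentElem_mem hclosed hx hx₀
  have hgf : g * f = 0 := horth g hg.1 hgx
  have mul_eq_self {p : A} (hp : p ∈ S) : g * p = p := by
    rw [mul_comm]
    exact mul_eq_of_le (hS.prop.1 hp).2 hg.1 (hg.2.1 p hp)
  have hpf {p : A} (hp : p ∈ S) : p * f = 0 :=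
    mul_eq_zero_of_mul_eq_self_of_mul_eq_zero hg.1 (mul_eq_self hp) hgf
  have hfS : f ∈ S := by
    refine hS.le_of_ge ⟨Set.insert_subset ⟨hfI, hf⟩ hS.prop.1, ?_⟩ (Set.subset_insert f S)
      (Set.mem_insert f S)
    exact hS.prop.2.insert fun p hp _ => ⟨by rw [mul_comm, hpf hp], hpf hp⟩
  exact hf₀ (by rw [← mul_eq_self hfS, hgf])

theorem IsIdeal.exists_isProjectionLUB_unit {I : Submodule ℝ A} (hI : IsIdeal I)
    (hclosed : IsClosed (I : Set A)) :
    ∃ S g, S ⊆ (I : Set A) ∩ projections A ∧ IsProjectionLUB S g ∧ ∀ x ∈ I, g * x = x := by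
  obtain ⟨S, hS⟩ := exists_maximal_pairwise_mul_eq_zero ((I : Set A) ∩ projections A)
  obtain ⟨g, hg⟩ := IsAJWAlgebra.exists_lub S (fun _ hp => (hS.prop.1 hp).2) hS.prop.2
  exact ⟨S, g, hS.prop.1, hg, fun x hx => hI.mul_eq_self_of_eq_zero_of_mul_eq_zero hg.1
    (fun y hy => hI.eq_zero_of_isProjectionLUB_mul_eq_zero hclosed hS hg hy) hx⟩

variable (A) in
theorem exists_unit : ∃ u : A, ∀ x, u * x = x := by
  have hI : IsIdeal (⊤ : Submodule ℝ A) := fun _ _ _ => trivial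
  obtain ⟨-, u, -, -, hu⟩ := hI.exists_isProjectionLUB_unit isClosed_univ
  exact ⟨u, fun x => hu x trivial⟩

theorem IsProjectionLUB.mul_isIdempotentElem_eq_zero {S : Set A} {g f : A}
    (hg : IsProjectionLUB S g) (hS : S ⊆ projections A) (hf : IsIdempotentElem f)
    (h : ∀ p ∈ S, p * f = 0) : g * f = 0 := by
  obtain ⟨u, hu⟩ := exists_unit A
  have mul_u (x : A) : x * u = x := by rw [mul_comm, hu]
  have complement {p : A} (hp : IsIdempotentElem p) : IsIdempotentElem (u - p) :=
    hp.sub (hu u) (mul_u p) (hu p)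
  have hle : Le g (u - f) := by
    refine hg.2.2 _ (complement hf) fun p hp => ⟨u - (f + p), ?_⟩
    rw [complement (hf.add (hS hp) (by rw [mul_comm f, h p hp, add_zero]))]
    abel
  have hgf := mul_eq_of_le hg.1 (complement hf) hle
  rwa [mul_sub, mul_u, sub_eq_self] at hgf

theorem IsProjectionLUB.mul_eq_zero {S : Set A} {g z : A} (hg : IsProjectionLUB S g)
    (hS : S ⊆ projections A) (hz : ∀ p ∈ S, p * z = 0) : g * z = 0 := by
  have hclosed : IsClosed {x : A | g * x = 0} :=
    isClosed_eq (continuous_const.mul continuous_id) continuous_const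
  refine hclosed.closure_subset (Metric.mem_closure_iff.2 fun ε hε => ?_)
  obtain ⟨f, hf, hfz, hnear⟩ := exists_isIdempotentElem_near z (half_pos hε)
  have hgf : g * f = 0 := hg.mul_isIdempotentElem_eq_zero hS hf fun p hp =>
    mul_eq_zero_of_mem_closure_range_U (hS hp) (hz p hp) hfz
  exact ⟨U f z, mul_U_eq_zero hg.1 hgf z, by rw [dist_eq_norm]; linarith⟩

section Unit

variable {I : Submodule ℝ A} {S : Set A} {g : A}

theorem IsIdeal.mem_center_of_isProjectionLUB (hI : IsIdeal I)
    (hS : S ⊆ (I : Set A) ∩ projections A) (hg : IsProjectionLUB S g)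
    (hunit : ∀ x ∈ I, g * x = x) : g ∈ Set.center A := by
  refine mem_center_of_mul_mul_eq hg.1 fun x => ?_
  have hz : 2 • (g * (g * x - g * (g * x))) = g * x - g * (g * x) :=
    two_nsmul_mul_sub_mul_mul hg.1 x
  set z := g * x - g * (g * x) with hz_def
  have hgz : g * z = 0 := by
    refine hg.mul_eq_zero (fun _ hp => (hS hp).2) fun p hp => ?_
    have hpz : p * z = 2 • (p * z) := by
      calc p * z = p * (2 • (g * z)) := by rw [hz]
        _ = 2 • (g * (p * z)) := by
          rw [mul_smul_comm, mul_mul_left_comm_of_mul_eq_self hg.1 (hunit p (hS hp).1)]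
        _ = 2 • (p * z) := by rw [hunit _ (mul_comm z p ▸ hI z p (hS hp).1)]
    rwa [two_nsmul, left_eq_add] at hpz
  rw [hgz, smul_zero] at hz
  exact (sub_eq_zero.1 (hz_def.symm.trans hz.symm)).symm

theorem IsIdeal.annPos_eq (hI : IsIdeal I) (hS : S ⊆ (I : Set A) ∩ projections A)
    (hg : IsProjectionLUB S g) (hunit : ∀ x ∈ I, g * x = x) :
    annPos (I : Set A) = {x | x ∈ posCone A ∧ g * x = 0} := by
  ext x
  refine and_congr_right fun _ => ⟨fun h => ?_, fun h b hb => ?_⟩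
  · refine hg.mul_eq_zero (fun _ hp => (hS hp).2) fun p hp => ?_
    have hpI : p ∈ I := (hS hp).1
    have hpxI : p * x ∈ I := mul_comm x p ▸ hI x p hpI
    exact mul_eq_zero_of_U_eq_zero (hS hp).2 (h p hpI) (h _ hpxI) (h _ (I.add_mem hpI hpxI))
  · exact U_eq_zero_of_mul_eq_self_of_mul_eq_zero hg.1 (hunit b hb) h

end Unit

end Ideal

end JBAlgebra

theorem lemma2p4 {A : Type*} [JBAlgebra A] [IsAJWAlgebra A] (I : Submodule ℝ A)
    (hI : JBAlgebra.IsIdeal I) (hclosed : IsClosed (I : Set A)) :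
    ∃ g : A, g ∈ JBAlgebra.projections A ∧ g ∈ Set.center A ∧
      JBAlgebra.annPos (JBAlgebra.annPos (I : Set A)) =
        {x | ∃ a ∈ JBAlgebra.posCone A, x = g * a} := by
  obtain ⟨u, hu⟩ := JBAlgebra.exists_unit A
  obtain ⟨S, g, hS, hg, hunit⟩ := hI.exists_isProjectionLUB_unit hclosed
  have hcenter : g ∈ Set.center A := hI.mem_center_of_isProjectionLUB hS hg hunit
  refine ⟨g, hg.1, hcenter, ?_⟩
  rw [hI.annPos_eq hS hg hunit, JBAlgebra.annPos_setOf_mul_eq_zero hu hg.1 hcenter]
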